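/- **Setting.** Let $R$ be a regular (Noetherian) ring of prime characteristic $p$ that is F-finite, i.e. $R$ is a finitely generated module over its subring $R^p$ of $p$-th powers. For an ideal $\mathfrak a\subseteq R$ and $e\in\mathbb N$ put $$\mathfrak a^{[1/p^e]}:=\sum_{\varphi\in\operatorname{Hom}_R(R^{1/p^e},R)}\varphi\big(\mathfrak a^{1/p^e}\big)\subseteq R .$$ For $n,e\in\mathbb N$ let $\tau(\mathfrak a^{n/p^e}):=\bigcup_{f\ge 0}(\mathfrak a^{np^f})^{[1/p^{e+f}]}$, an increasing union, and for a real number $t\ge 0$ let $$\tau(\mathfrak a^t)=\tau(R,\mathfrak a^t):=\bigcup_{e\in\mathbb N}\tau\big(\mathfrak a^{\lceil tp^e\rceil/p^e}\big).$$ The same definitions are used for the localizations and quotients of $R$ below. For ideals $\mathfrak a,\mathfrak b$ and $t,s\ge 0$ the mixed test ideal $\tau(\mathfrak a^t\mathfrak b^s)$ is the value, for $e\gg 0$, of the increasing chain $(\mathfrak a^{\lceil tp^e\rceil}\mathfrak b^{\lceil sp^e\rceil})^{[1/p^e]}$. An element $x\in R$ is called a regular parameter if it is not a unit and, for every maximal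 ideal $\mathfrak m\ni x$, its image in $R_{\mathfrak m}$ is not in $\mathfrak m^2R_{\mathfrak m}$ (so that $x$ is part of a regular system of parameters of $R_{\mathfrak m}$). **Theorem.** Let $R$ be an F-finite regular ring of prime characteristic $p$, with ideals $\mathfrak a,\mathfrak b$. Then: 1. If $\mathfrak a\subseteq\mathfrak b$, then $\tau(\mathfrak a^t)\subseteq\tau(\mathfrak b^t)$ for all real $t>0$. 2. If $t\ge t'\ge 0$, then $\tau(\mathfrak a^t)\subseteq\tau(\mathfrak a^{t'})$. 3. $\tau((\mathfrak a^n)^t)=\tau(\mathfrak a^{nt})$ for every integer $n\ge 1$ and every real $t>0$. 4. For every multiplicatively closed set $W\subseteq R$ and every real $t\ge 0$, $\tau(R,\mathfrak a^t)\,RW^{-1}=\tau(RW^{-1},(\mathfrak a RW^{-1})^t)$. 5. If $\overline{\mathfrak a}$ is the integral closure of $\mathfrak a$, i.e. the ideal of all $r\in R$ satisfying an equation $r^n+c_1r^{n-1}+\dots+c_n=0$ with $n\ge 1$ and $c_i\in\mathfrak a^i$, then $\tau(\overline{\mathfrak a}^{\,t})=\tau(\mathfrak a^t)$ for all real $t\ge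 0$. 6. For each real $t>0$ there is $\varepsilon>0$ such that $\tau(\mathfrak a^{t'})=\tau(\mathfrak a^t)$ for all $t'\in[t,t+\varepsilon)$. 7. $\mathfrak a\subseteq\tau(\mathfrak a)=\tau(\mathfrak a^1)$. 8. (Briançon–Skoda) If $\mathfrak a$ can be generated by $r$ elements, then $\tau(\mathfrak a^\ell)=\mathfrak a\,\tau(\mathfrak a^{\ell-1})$ for every integer $\ell\ge\max(r,1)$. 9. (Restriction) If $x\in R$ is a regular parameter, then, writing $\mathfrak a \bmod x$ for the image of $\mathfrak a$ in $R/(x)$, $\tau((\mathfrak a\bmod x)^t)\subseteq\tau(\mathfrak a^t)\bmod x$ for all real $t\ge 0$. 10. (Subadditivity) If $R$ is essentially of finite type over a perfect field, then $\tau(\mathfrak a^{tn})\subseteq\tau(\mathfrak a^t)^n$ for all real $t\ge 0$ and all $n\in\mathbb N$; more generally, $\tau(\mathfrak a^t\mathfrak b^s)\subseteq\tau(\mathfrak a^t)\,\tau(\mathfrak b^s)$ for all real $t,s\ge 0$. -/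

import Mathlib

namespace TestIdeals

universe u

/-- A ring `R` of prime characteristic `p` is F-finite if it is a finitely generated module over
its subring of `p`-th powers, i.e. if the Frobenius map `R → R` is finite. -/
def IsFFinite (p : ℕ) (R : Type u) [CommRing R] [Fact p.Prime] [CharP R p] : Prop :=
  (frobenius R p).Finite

section Definitions

variable {R : Type u} [CommRing R]

/-- For `q = p ^ e` and `R` a reduced ring of characteristic `p`, identify `R^{1/q}` with `R`
through `x^{1/q} ↔ x`. The element `r` of `R` then acts on `R^{1/q}` by
`r • x^{1/q} = (r ^ q * x)^{1/q}`, so an `R`-linear map `R^{1/q} → R` is exactly an additive map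
`φ : R → R` such that `φ (r ^ q * x) = r * φ x`. -/
def IsRootLinear (q : ℕ) (φ : R →+ R) : Prop :=
  ∀ r x : R, φ (r ^ q * x) = r * φ x

/-- The ideal `𝔞^{[1/p^e]}`: the sum of the images `φ(𝔞^{1/p^e})` over all `R`-linear maps
`φ : R^{1/p^e} → R`. -/
def rootIdeal (p e : ℕ) (𝔞 : Ideal R) : Ideal R :=
  Ideal.span {y : R | ∃ φ : R →+ R, IsRootLinear (p ^ e) φ ∧ ∃ x ∈ 𝔞, y = φ x}

/-- The test ideal `τ(𝔞^{n/p^e})`: the union over `f` of the ideals `(𝔞^{n p^f})^{[1/p^{e+f}]}`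
(they form an increasing chain in a regular F-finite ring, so that union and supremum agree). -/
def testIdealFrac (p : ℕ) (𝔞 : Ideal R) (n e : ℕ) : Ideal R :=
  ⨆ f : ℕ, rootIdeal p (e + f) (𝔞 ^ (n * p ^ f))

/-- The test ideal `τ(R, 𝔞^t)` for a real number `t ≥ 0`: the union over `e` of the ideals
`τ(𝔞^{⌈t p^e⌉/p^e})` (again an increasing chain). -/
noncomputable def testIdeal (p : ℕ) (𝔞 : Ideal R) (t : ℝ) : Ideal R :=
  ⨆ e : ℕ, testIdealFrac p 𝔞 ⌈t * (p : ℝ) ^ e⌉₊ e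

/-- The mixed test ideal `τ(𝔞^t 𝔟^s)`: the value for large `e` of the increasing chain of ideals
`(𝔞^{⌈t p^e⌉} 𝔟^{⌈s p^e⌉})^{[1/p^e]}`. -/
noncomputable def mixedTestIdeal (p : ℕ) (𝔞 𝔟 : Ideal R) (t s : ℝ) : Ideal R :=
  ⨆ e : ℕ, rootIdeal p e (𝔞 ^ ⌈t * (p : ℝ) ^ e⌉₊ * 𝔟 ^ ⌈s * (p : ℝ) ^ e⌉₊)

/-- An element `x` of a regular ring is a regular parameter if it is not a unit and, in the local
ring at every maximal ideal `𝔪` that contains it, it is part of a regular system of parameters,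
i.e. it lies in the maximal ideal but not in its square. -/
def IsRegularParameter (x : R) : Prop :=
  ¬ IsUnit x ∧ ∀ (𝔪 : Ideal R) [𝔪.IsMaximal], x ∈ 𝔪 →
    algebraMap R (Localization.AtPrime 𝔪) x ∉
      (IsLocalRing.maximalIdeal (Localization.AtPrime 𝔪)) ^ 2

/-- `r` is integral over the ideal `𝔞`: it satisfies an equation
`r^n + c₁ r^{n-1} + ⋯ + cₙ = 0` with `n ≥ 1` and `cᵢ ∈ 𝔞^i`. -/
def IsIntegralOverIdeal (𝔞 : Ideal R) (r : R) : Prop :=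
  ∃ n : ℕ, 0 < n ∧ ∃ c : ℕ → R, (∀ i ∈ Finset.Icc 1 n, c i ∈ 𝔞 ^ i) ∧
    r ^ n + ∑ i ∈ Finset.Icc 1 n, c i * r ^ (n - i) = 0

open Polynomial in
theorem isIntegralOverIdeal_iff (𝔞 : Ideal R) (r : R) :
    IsIntegralOverIdeal 𝔞 r ↔ IsIntegral (reesAlgebra 𝔞) (monomial 1 r : R[X]) := by
  constructor
  · rintro ⟨n, hn, c, hc, h⟩
    let d : ℕ → reesAlgebra 𝔞 := fun i =>
      if hi : i ∈ Finset.Icc 1 n then ⟨monomial i (c i), reesAlgebra.monomial_mem.2 (hc i hi)⟩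
      else 0
    refine ⟨X ^ n + ∑ i ∈ Finset.Icc 1 n, C (d i) * X ^ (n - i), ?_, ?_⟩
    · apply monic_X_pow_add
      refine mem_degreeLT.1 (Submodule.sum_mem _ fun i hi => mem_degreeLT.2 ?_)
      refine (degree_C_mul_X_pow_le _ _).trans_lt ?_
      have := Finset.mem_Icc.1 hi
      exact_mod_cast (by omega : n - i < n)
    · have key : ∀ i ∈ Finset.Icc 1 n,
          (algebraMap (reesAlgebra 𝔞) R[X] (d i)) * (monomial 1 r : R[X]) ^ (n - i) =
            monomial n (c i * r ^ (n - i)) := by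
        intro i hi
        have hd : algebraMap (reesAlgebra 𝔞) R[X] (d i) = monomial i (c i) := by
          simp only [d, dif_pos hi]
          rfl
        have := Finset.mem_Icc.1 hi
        rw [hd, monomial_pow, monomial_mul_monomial, show i + 1 * (n - i) = n by omega]
      rw [eval₂_add, eval₂_finsetSum, eval₂_X_pow]
      simp only [eval₂_mul, eval₂_C, eval₂_X_pow]
      rw [Finset.sum_congr rfl key, monomial_pow, ← map_sum, one_mul, ← map_add, h, map_zero]
  · rintro ⟨P, hP, h⟩
    rcases subsingleton_or_nontrivial R with hR | hR
    · exact ⟨1, one_pos, 0, fun _ _ => zero_mem _, Subsingleton.elim _ _⟩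
    set n := P.natDegree with hn
    have hpos : 0 < n := by
      rcases Nat.eq_zero_or_pos n with h0 | h0
      · have h1 : P = 1 := hP.natDegree_eq_zero.1 h0
        rw [h1, eval₂_one] at h
        exact absurd h one_ne_zero
      · exact h0
    refine ⟨n, hpos, fun i => (P.coeff (n - i)).1.coeff i, fun i _ => (P.coeff (n - i)).2 i, ?_⟩
    rw [eval₂_eq_sum_range, ← hn, Finset.sum_range_succ] at h
    have h2 := congrArg (fun f : R[X] => f.coeff n) h
    have hlc : P.coeff n = 1 := hP
    have hterm : ∀ j, j ≤ n → (algebraMap (reesAlgebra 𝔞) R[X] (P.coeff j) *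
        (monomial 1 r : R[X]) ^ j).coeff n = (P.coeff j).1.coeff (n - j) * r ^ j := by
      intro j hj
      obtain ⟨k, hk⟩ := Nat.exists_eq_add_of_le' hj
      rw [monomial_pow, one_mul, hk, coeff_mul_monomial, Nat.add_sub_cancel]
      rfl
    simp only [coeff_add, finsetSum_coeff, coeff_zero] at h2
    rw [hterm n le_rfl, hlc, Finset.sum_congr rfl
      (fun j hj => hterm j (Finset.mem_range.1 hj).le), add_comm] at h2
    have h3 : ∑ i ∈ Finset.Icc 1 n, (P.coeff (n - i)).1.coeff i * r ^ (n - i) =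
        ∑ j ∈ Finset.range n, (P.coeff j).1.coeff (n - j) * r ^ j := by
      refine Finset.sum_bij' (fun i _ => n - i) (fun j _ => n - j) ?_ ?_ ?_ ?_ ?_
      · intro i hi
        have := Finset.mem_Icc.1 hi
        exact Finset.mem_range.2 (by omega)
      · intro j hj
        have := Finset.mem_range.1 hj
        exact Finset.mem_Icc.2 (by omega)
      · intro i hi
        have := Finset.mem_Icc.1 hi
        omega
      · intro j hj
        have := Finset.mem_range.1 hj
        omega
      · intro i hi
        have := Finset.mem_Icc.1 hi
        rw [Nat.sub_sub_self this.2]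
    rw [h3]
    simpa using h2

/-- The integral closure of an ideal: the ideal of all elements integral over it. -/
def idealIntegralClosure (𝔞 : Ideal R) : Ideal R where
  carrier := {r | IsIntegralOverIdeal 𝔞 r}
  zero_mem' := by
    simp only [Set.mem_ofPred_eq, isIntegralOverIdeal_iff, map_zero]
    exact isIntegral_zero
  add_mem' := by
    intro a b ha hb
    simp only [Set.mem_ofPred_eq, isIntegralOverIdeal_iff, map_add] at ha hb ⊢
    exact ha.add hb
  smul_mem' := by
    rintro s r ⟨n, hn, c, hc, h⟩
    refine ⟨n, hn, fun i => s ^ i * c i, fun i hi => Ideal.mul_mem_left _ _ (hc i hi), ?_⟩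
    have key : ∀ i ∈ Finset.Icc 1 n,
        s ^ i * c i * (s • r) ^ (n - i) = s ^ n * (c i * r ^ (n - i)) := by
      intro i hi
      have hi' := Finset.mem_Icc.1 hi
      obtain ⟨k, hk⟩ := Nat.exists_eq_add_of_le hi'.2
      rw [hk, Nat.add_sub_cancel_left, smul_eq_mul]
      ring
    rw [Finset.sum_congr rfl key, ← Finset.mul_sum, smul_eq_mul, mul_pow, ← mul_add, h, mul_zero]

end Definitions

end TestIdeals

/-! Everything rests on Kunz's theorem: for `R` regular and F-finite, `R^{1/p}` is finite projective
over `R`. Dual coordinates then write each `y` as `∑ φᵢ(y)^q xᵢ` with `q = p ^ e`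
(`HasFrobeniusBasis`). Substituting this expansion shows that root ideals are submultiplicative and
compatible with ring maps, which gives subadditivity, restriction and half of localization. It also
makes the chain defining the test ideal increasing, hence stationary in a Noetherian ring.

The hard point is right continuity, `exists_gt_testIdeal_le`, which comes from Krull's intersection
theorem. It replaces `t` by some `s > t`, and the gap `(s - t) p^e` eventually swallows any bounded
error in exponents: the rounding error for powers, or the constant `k` for which the `m`-th power of
the integral closure lies in `𝔞 ^ (m - k)`. Briançon–Skoda is a pigeonhole count on products of
generators.

Kunz's theorem is proved locally: the maximal ideal is generated by a regular sequence, the `p`-th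
powers of that sequence are again regular, so the sequence itself is regular on the Frobenius
pushforward, and this forces freeness. -/

namespace TestIdeals

/-! ### Root-linear maps and root ideals. -/

section RootLinear

variable {R : Type*} [CommRing R]

theorem IsRootLinear.comp {q q' : ℕ} {φ ψ : R →+ R} (hφ : IsRootLinear q φ)
    (hψ : IsRootLinear q' ψ) : IsRootLinear (q * q') (φ.comp ψ) := by
  intro r x
  simp only [AddMonoidHom.comp_apply]
  rw [pow_mul, hψ, hφ]

theorem IsRootLinear.comp_mulLeft {q : ℕ} {φ : R →+ R} (hφ : IsRootLinear q φ) (s : R) :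
    IsRootLinear q (φ.comp (AddMonoidHom.mulLeft s)) := by
  intro r x
  simp only [AddMonoidHom.comp_apply, AddMonoidHom.coe_mulLeft]
  rw [mul_left_comm, hφ]

theorem IsRootLinear.id : IsRootLinear 1 (AddMonoidHom.id R) := by
  intro r x
  simp

theorem mem_rootIdeal {p e : ℕ} {𝔞 : Ideal R} {φ : R →+ R} (hφ : IsRootLinear (p ^ e) φ)
    {x : R} (hx : x ∈ 𝔞) : φ x ∈ rootIdeal p e 𝔞 :=
  Ideal.subset_span ⟨φ, hφ, x, hx, rfl⟩

theorem rootIdeal_le {p e : ℕ} {𝔞 J : Ideal R} :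
    rootIdeal p e 𝔞 ≤ J ↔
      ∀ φ : R →+ R, IsRootLinear (p ^ e) φ → ∀ x ∈ 𝔞, φ x ∈ J := by
  constructor
  · exact fun h φ hφ x hx => h (mem_rootIdeal hφ hx)
  · rintro h
    refine Ideal.span_le.2 ?_
    rintro _ ⟨φ, hφ, x, hx, rfl⟩
    exact h φ hφ x hx

theorem rootIdeal_mono {p e : ℕ} {𝔞 𝔟 : Ideal R} (h : 𝔞 ≤ 𝔟) :
    rootIdeal p e 𝔞 ≤ rootIdeal p e 𝔟 :=
  rootIdeal_le.2 fun _ hφ _ hx => mem_rootIdeal hφ (h hx)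

theorem le_rootIdeal_zero (p : ℕ) (𝔞 : Ideal R) : 𝔞 ≤ rootIdeal p 0 𝔞 := fun x hx =>
  mem_rootIdeal (φ := AddMonoidHom.id R) (by rw [pow_zero]; exact IsRootLinear.id) hx

/-- The elements whose images under all `q`-root-linear maps lie in `J`. When `R^{1/q}` is
projective over `R` this is the ideal generated by the `q`-th powers of the elements of `J`. -/
def frobeniusPower (q : ℕ) (J : Ideal R) : Ideal R where
  carrier := {y | ∀ φ : R →+ R, IsRootLinear q φ → φ y ∈ J}
  zero_mem' := fun φ _ => by simp
  add_mem' := fun ha hb φ hφ => by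
    rw [map_add]
    exact J.add_mem (ha φ hφ) (hb φ hφ)
  smul_mem' := fun c _ hx _ hφ => hx _ (hφ.comp_mulLeft c)

/-- An adjunction: it moves a bound on a root ideal to the ideal before roots are taken. -/
theorem rootIdeal_le_iff_le_frobeniusPower {p e : ℕ} {𝔞 J : Ideal R} :
    rootIdeal p e 𝔞 ≤ J ↔ 𝔞 ≤ frobeniusPower (p ^ e) J := by
  rw [rootIdeal_le]
  exact ⟨fun h x hx φ hφ => h φ hφ x hx, fun h φ hφ x hx => h hx φ hφ⟩

/-- Root-linearity moves a factor inside: `y * φ x = φ (y ^ q * x)`. -/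
theorem mul_rootIdeal_le {p e : ℕ} {𝔞 𝔟 𝔠 : Ideal R} (h : ∀ y ∈ 𝔞, ∀ z ∈ 𝔟, y ^ p ^ e * z ∈ 𝔠) :
    𝔞 * rootIdeal p e 𝔟 ≤ rootIdeal p e 𝔠 := by
  refine Ideal.mul_le.2 fun y hy z hz => ?_
  suffices rootIdeal p e 𝔟 ≤ Submodule.comap (LinearMap.mulLeft R y) (rootIdeal p e 𝔠) from this hz
  refine rootIdeal_le.2 fun φ hφ x hx => ?_
  rw [Submodule.mem_comap, LinearMap.mulLeft_apply, ← hφ]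
  exact mem_rootIdeal hφ (h y hy x hx)

theorem rootIdeal_span_pow_mul_le {p e : ℕ} {ι : Type*} (g : ι → R) (𝔟 : Ideal R) :
    rootIdeal p e (Ideal.span (Set.range fun i => g i ^ p ^ e) * 𝔟) ≤
      Ideal.span (Set.range g) * rootIdeal p e 𝔟 := by
  rw [rootIdeal_le_iff_le_frobeniusPower, Ideal.mul_le]
  intro y hy z hz
  suffices Ideal.span (Set.range fun i => g i ^ p ^ e) ≤ Submodule.comap
      (LinearMap.mulRight R z)
      (frobeniusPower (p ^ e) (Ideal.span (Set.range g) * rootIdeal p e 𝔟)) from this hy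
  refine Ideal.span_le.2 ?_
  rintro _ ⟨i, rfl⟩
  intro φ hφ
  rw [LinearMap.mulRight_apply, hφ]
  exact Ideal.mul_mem_mul (Ideal.subset_span ⟨i, rfl⟩) (mem_rootIdeal hφ hz)

end RootLinear

/-! ### Consequences of the coordinate expansion. -/

section FrobeniusBasis

/-- `R` has finite projective coordinates for `R^{1/q}` over `R`: every `y` is
`∑ φᵢ(y)^q xᵢ` for finitely many `q`-root-linear maps `φᵢ` and elements `xᵢ`. -/
def HasFrobeniusBasis (q : ℕ) (R : Type*) [CommRing R] : Prop :=
  ∃ (ι : Type) (_ : Fintype ι) (φ : ι → R →+ R) (x : ι → R),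
    (∀ i, IsRootLinear q (φ i)) ∧ ∀ y, y = ∑ i, φ i y ^ q * x i

variable {R : Type*} [CommRing R]

theorem HasFrobeniusBasis.one : HasFrobeniusBasis 1 R :=
  ⟨Unit, inferInstance, fun _ => AddMonoidHom.id R, fun _ => 1, fun _ => IsRootLinear.id,
    fun y => by simp⟩

theorem HasFrobeniusBasis.pow {p : ℕ} [Fact p.Prime] [CharP R p] (h : HasFrobeniusBasis p R)
    (e : ℕ) : HasFrobeniusBasis (p ^ e) R := by
  induction e with
  | zero => simpa using HasFrobeniusBasis.one
  | succ e ih =>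
    obtain ⟨ι, _, φ, x, hφ, hx⟩ := h
    obtain ⟨κ, _, ψ, z, hψ, hz⟩ := ih
    refine ⟨κ × ι, inferInstance, fun i => (φ i.2).comp (ψ i.1),
      fun i => x i.2 ^ p ^ e * z i.1, fun i => ?_, fun y => ?_⟩
    · rw [pow_succ']
      exact (hφ _).comp (hψ _)
    · rw [Fintype.sum_prod_type]
      conv_lhs => rw [hz y]
      refine Finset.sum_congr rfl fun k _ => ?_
      conv_lhs => rw [hx (ψ k y), sum_pow_char_pow, Finset.sum_mul]
      refine Finset.sum_congr rfl fun i _ => ?_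
      rw [AddMonoidHom.comp_apply, pow_succ', pow_mul, mul_pow, mul_assoc]

theorem HasFrobeniusBasis.rootIdeal_top {p e : ℕ} (hp : p ≠ 0)
    (h : HasFrobeniusBasis (p ^ e) R) : rootIdeal p e (⊤ : Ideal R) = ⊤ := by
  obtain ⟨ι, _, φ, x, hφ, hx⟩ := h
  rw [Ideal.eq_top_iff_one, hx 1]
  exact Ideal.sum_mem _ fun i _ => Ideal.mul_mem_right _ _ <|
    Ideal.pow_mem_of_mem _ (mem_rootIdeal (hφ i) Submodule.mem_top) _
      (pow_pos (Nat.pos_of_ne_zero hp) _)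

/-- The source of all monotone chains below. Since the first root ideal of `⊤` is `⊤`, the identity
`y * ψ z = ψ (y ^ p * z)` puts `𝔞` inside the first root ideal of `𝔟`; composing root-linear maps
then gives level `e + 1`. -/
theorem HasFrobeniusBasis.rootIdeal_le_succ {p e : ℕ} (hp : p ≠ 0) (h : HasFrobeniusBasis p R)
    {𝔞 𝔟 : Ideal R} (hab : ∀ y ∈ 𝔞, y ^ p ∈ 𝔟) : rootIdeal p e 𝔞 ≤ rootIdeal p (e + 1) 𝔟 := by
  have h1 : 𝔞 ≤ rootIdeal p 1 𝔟 := by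
    rw [← Ideal.mul_top 𝔞, ← HasFrobeniusBasis.rootIdeal_top (e := 1) hp (by simpa using h)]
    exact mul_rootIdeal_le fun y hy z _ => Ideal.mul_mem_right _ _ (by simpa using hab y hy)
  refine rootIdeal_le.2 fun φ hφ x hx => ?_
  have h2 : rootIdeal p 1 𝔟 ≤ frobeniusPower (p ^ e) (rootIdeal p (e + 1) 𝔟) := by
    rw [rootIdeal_le]
    intro ψ hψ y hy φ hφ
    refine mem_rootIdeal (φ := φ.comp ψ) ?_ hy
    rw [pow_add]
    exact hφ.comp hψ
  exact h2 (h1 hx) φ hφ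

theorem HasFrobeniusBasis.rootIdeal_mul_le {p e : ℕ} (h : HasFrobeniusBasis (p ^ e) R)
    (𝔞 𝔟 : Ideal R) : rootIdeal p e (𝔞 * 𝔟) ≤ rootIdeal p e 𝔞 * rootIdeal p e 𝔟 := by
  obtain ⟨ι, _, χ, x, hχ, hx⟩ := h
  rw [rootIdeal_le_iff_le_frobeniusPower, Ideal.mul_le]
  intro u hu v hv φ hφ
  have key : φ (u * v) = ∑ i, ∑ j, χ i u * χ j v * φ (x i * x j) := by
    conv_lhs => rw [hx u, hx v, Finset.sum_mul_sum, map_sum]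
    refine Finset.sum_congr rfl fun i _ => ?_
    rw [map_sum]
    refine Finset.sum_congr rfl fun j _ => ?_
    rw [← hφ]
    congr 1
    ring
  rw [key]
  exact Ideal.sum_mem _ fun i _ => Ideal.sum_mem _ fun j _ => Ideal.mul_mem_right _ _ <|
    Ideal.mul_mem_mul (mem_rootIdeal (hχ i) hu) (mem_rootIdeal (hχ j) hv)

/-- For `φ` on `S`, expanding `u` in `R` gives `φ (f u) = ∑ f (χ i u) * φ (f (x i))`, so only
coordinates of the source are needed. -/
theorem HasFrobeniusBasis.rootIdeal_map_le {p e : ℕ} (h : HasFrobeniusBasis (p ^ e) R)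
    {S : Type*} [CommRing S] (f : R →+* S) (𝔞 : Ideal R) :
    rootIdeal p e (𝔞.map f) ≤ (rootIdeal p e 𝔞).map f := by
  obtain ⟨ι, _, χ, x, hχ, hx⟩ := h
  rw [rootIdeal_le_iff_le_frobeniusPower, Ideal.map_le_iff_le_comap]
  intro u hu φ hφ
  rw [hx u, map_sum, map_sum]
  refine Ideal.sum_mem _ fun i _ => ?_
  rw [map_mul, map_pow, hφ]
  exact Ideal.mul_mem_right _ _ (Ideal.mem_map_of_mem _ (mem_rootIdeal (hχ i) hu))

theorem HasFrobeniusBasis.mem_pow {q : ℕ} (h : HasFrobeniusBasis q R) {K : Ideal R} {v : R}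
    (hv : v ∈ frobeniusPower q K) : v ∈ K ^ q := by
  obtain ⟨ι, _, χ, x, hχ, hx⟩ := h
  rw [hx v]
  exact Ideal.sum_mem _ fun i _ => Ideal.mul_mem_right _ _ (Ideal.pow_mem_pow (hv _ (hχ i)) _)

end FrobeniusBasis

/-! ### Extending root-linear maps to localizations. -/

section Localization

variable {R : Type*} [CommRing R] {S : Type*} [CommRing S] [Algebra R S]

/-- With `q = m + 1`, writing `r / w = r w^m / w^q` forces `ψ (r / w) = φ (r w^m) / w`. -/
theorem IsRootLinear.exists_localization (W : Submonoid R) [IsLocalization W S] {q : ℕ} (hq : 0 < q) {φ : R →+ R}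
    (hφ : IsRootLinear q φ) :
    ∃ ψ : S →+ S, IsRootLinear q ψ ∧ ∀ r, ψ (algebraMap R S r) = algebraMap R S (φ r) := by
  obtain ⟨m, rfl⟩ : ∃ m, q = m + 1 := ⟨q - 1, by omega⟩
  let ψ : S → S := fun s => IsLocalization.mk' S
    (φ ((IsLocalization.sec W s).1 * ((IsLocalization.sec W s).2 : R) ^ m))
    (IsLocalization.sec W s).2
  have hψ : ∀ (r : R) (w : W), ψ (IsLocalization.mk' S r w) =
      IsLocalization.mk' S (φ (r * (w : R) ^ m)) w := by
    intro r w
    simp only [ψ]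
    set r' := (IsLocalization.sec W (IsLocalization.mk' S r w)).1
    set w' := (IsLocalization.sec W (IsLocalization.mk' S r w)).2
    have h : IsLocalization.mk' S r' w' = IsLocalization.mk' S r w := IsLocalization.mk'_sec _ _
    rw [IsLocalization.mk'_eq_iff_eq, IsLocalization.eq_iff_exists W] at h ⊢
    obtain ⟨c, hc⟩ := h
    refine ⟨c, ?_⟩
    rw [← mul_assoc, ← mul_assoc, ← hφ, ← hφ]
    congr 1
    calc (↑c * ↑w) ^ (m + 1) * (r' * (w' : R) ^ m)
        = (c * (w * r')) * (c * w * w') ^ m := by ring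
      _ = (c * (w' * r)) * (c * w * w') ^ m := by rw [hc]
      _ = _ := by ring
  refine ⟨AddMonoidHom.mk' ψ ?_, ?_, ?_⟩
  · intro a b
    obtain ⟨r, w, rfl⟩ := IsLocalization.exists_mk'_eq W a
    obtain ⟨s, v, rfl⟩ := IsLocalization.exists_mk'_eq W b
    rw [← IsLocalization.mk'_add, hψ, hψ, hψ, ← IsLocalization.mk'_add]
    congr 1
    rw [mul_comm (φ _), mul_comm (φ _), ← hφ, ← hφ, ← map_add]
    congr 1
    push_cast
    ring
  · intro a b
    obtain ⟨r, w, rfl⟩ := IsLocalization.exists_mk'_eq W a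
    obtain ⟨s, v, rfl⟩ := IsLocalization.exists_mk'_eq W b
    simp only [AddMonoidHom.mk'_apply]
    rw [← IsLocalization.mk'_pow, ← IsLocalization.mk'_mul, hψ, hψ, ← IsLocalization.mk'_mul,
      ← hφ, IsLocalization.mk'_eq_iff_eq]
    congr 1
    rw [← hφ, ← hφ]
    congr 1
    push_cast
    ring
  · intro r
    have := hψ r 1
    rw [IsLocalization.mk'_one] at this
    rw [AddMonoidHom.mk'_apply, this, Submonoid.coe_one, one_pow, mul_one, IsLocalization.mk'_one]

theorem map_rootIdeal_le (W : Submonoid R) [IsLocalization W S] {p e : ℕ} (hp : p ≠ 0) (𝔞 : Ideal R) :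
    (rootIdeal p e 𝔞).map (algebraMap R S) ≤ rootIdeal p e (𝔞.map (algebraMap R S)) := by
  rw [Ideal.map_le_iff_le_comap]
  refine rootIdeal_le.2 fun φ hφ x hx => ?_
  obtain ⟨ψ, hψ, h⟩ := IsRootLinear.exists_localization W (S := S) (pow_pos (Nat.pos_of_ne_zero hp) _) hφ
  rw [Ideal.mem_comap, ← h]
  exact mem_rootIdeal hψ (Ideal.mem_map_of_mem _ hx)

end Localization

/-! ### Powers of ideals and integral closure. -/

section Powers

variable {R : Type*} [CommRing R]

/-- Pigeonhole: in a product of more than `r * (q - 1)` generators, some generator occurs at least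
`q` times. -/
theorem span_range_pow_le {r : ℕ} (g : Fin r → R) {q M : ℕ} (hM : r * (q - 1) < M) :
    Ideal.span (Set.range g) ^ M ≤
      Ideal.span (Set.range fun i => g i ^ q) * Ideal.span (Set.range g) ^ (M - q) := by
  rw [Ideal.span, Submodule.span_pow]
  refine Submodule.span_le.2 ?_
  intro y hy
  rw [Set.mem_pow] at hy
  obtain ⟨f, rfl⟩ := hy
  choose c hc using fun j => (f j).2
  obtain ⟨i, -, hi⟩ := Finset.exists_lt_card_fiber_of_mul_lt_card_of_maps_to
    (s := (Finset.univ : Finset (Fin M))) (t := Finset.univ) (f := c) (n := q - 1)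
    (fun _ _ => Finset.mem_univ _) (by simpa using hM)
  obtain ⟨T, hT, hTq⟩ := Finset.exists_subset_card_eq (n := q)
    (s := Finset.univ.filter fun j => c j = i) (by omega)
  rw [SetLike.mem_coe, List.prod_ofFn, ← Finset.prod_mul_prod_compl T]
  refine Ideal.mul_mem_mul ?_ ?_
  · refine Ideal.subset_span ⟨i, ?_⟩
    rw [← hTq]
    refine (Finset.prod_eq_pow_card fun j hj => ?_).symm
    rw [← hc, (Finset.mem_filter.1 (hT hj)).2]
  · have : Tᶜ.card = M - q := by rw [Finset.card_compl, Fintype.card_fin, hTq]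
    rw [← this, ← Finset.prod_const]
    exact Ideal.prod_mem_prod fun j _ => Ideal.subset_span (f j).2

theorem sup_pow_le_pow_sub {𝔞 𝔟 𝔠 : Ideal R} {k l : ℕ} (hb : ∀ m, 𝔟 ^ m ≤ 𝔞 ^ (m - k))
    (hc : ∀ m, 𝔠 ^ m ≤ 𝔞 ^ (m - l)) (m : ℕ) : (𝔟 ⊔ 𝔠) ^ m ≤ 𝔞 ^ (m - (k + l)) := by
  rw [← Ideal.add_eq_sup, add_pow, Ideal.sum_eq_sup, Finset.sup_le_iff]
  intro i hi
  refine (Ideal.mul_le_left (J := ((m.choose i : ℕ) : Ideal R))).trans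
    ((Ideal.mul_mono (hb _) (hc _)).trans ?_)
  rw [← pow_add]
  exact Ideal.pow_le_pow_right (by have := Finset.mem_range.1 hi; omega)

theorem IsIntegralOverIdeal.exists_pow_mem {𝔞 : Ideal R} {r : R} (h : IsIntegralOverIdeal 𝔞 r) :
    ∃ k, ∀ m, r ^ m ∈ 𝔞 ^ (m - k) := by
  obtain ⟨n, hn, c, hc, h⟩ := h
  refine ⟨n, fun m => ?_⟩
  induction m using Nat.strong_induction_on with
  | _ m ih =>
    rcases le_or_gt m n with hm | hm
    -- The truncated exponent is `0` here, so the ideal is the whole ring.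
    · simp [Nat.sub_eq_zero_of_le hm]
    · obtain ⟨d, rfl⟩ := Nat.exists_eq_add_of_lt hm
      have h1 : r ^ (n + d + 1) = -∑ i ∈ Finset.Icc 1 n, c i * r ^ (n + d + 1 - i) := by
        rw [add_assoc, pow_add, eq_neg_of_add_eq_zero_left h, neg_mul, Finset.sum_mul]
        congr 1
        refine Finset.sum_congr rfl fun i hi => ?_
        rw [mul_assoc, ← pow_add]
        have := Finset.mem_Icc.1 hi
        congr 2
        omega
      rw [h1]
      refine neg_mem (Ideal.sum_mem _ fun i hi => ?_)
      have hi' := Finset.mem_Icc.1 hi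
      have h2 := Ideal.mul_mem_mul (hc i hi) (ih (n + d + 1 - i) (by omega))
      rw [← pow_add] at h2
      exact Ideal.pow_le_pow_right (by omega) h2

theorem exists_idealIntegralClosure_pow_le [IsNoetherianRing R] (𝔞 : Ideal R) :
    ∃ k, ∀ m, idealIntegralClosure 𝔞 ^ m ≤ 𝔞 ^ (m - k) := by
  have key : ∀ 𝔟 : Ideal R, 𝔟 ≤ idealIntegralClosure 𝔞 → ∃ k, ∀ m, 𝔟 ^ m ≤ 𝔞 ^ (m - k) := by
    intro 𝔟
    -- The claim is proved for all finitely generated ideals inside the closure, so that it can be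
    -- built up from principal ones; the constants add.
    refine Submodule.fg_induction
      (motive := fun 𝔟 _ => 𝔟 ≤ idealIntegralClosure 𝔞 → ∃ k, ∀ m, 𝔟 ^ m ≤ 𝔞 ^ (m - k)) ?_ ?_ 𝔟
      (IsNoetherian.noetherian 𝔟)
    · intro x hx
      obtain ⟨k, hk⟩ := IsIntegralOverIdeal.exists_pow_mem (𝔞 := 𝔞) (r := x)
        (hx (Submodule.mem_span_singleton_self x))
      refine ⟨k, fun m => ?_⟩
      rw [← Ideal.span, Ideal.span_singleton_pow, Ideal.span_singleton_le_iff_mem]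
      exact hk m
    · intro 𝔟 𝔠 _ _ hb hc h
      obtain ⟨k, hk⟩ := hb (le_sup_left.trans h)
      obtain ⟨l, hl⟩ := hc (le_sup_right.trans h)
      exact ⟨k + l, sup_pow_le_pow_sub hk hl⟩
  exact key _ le_rfl

theorem le_idealIntegralClosure (𝔞 : Ideal R) : 𝔞 ≤ idealIntegralClosure 𝔞 := by
  intro r hr
  refine ⟨1, one_pos, fun _ => -r, ?_, by simp⟩
  intro i hi
  obtain rfl : i = 1 := by simpa using hi
  simpa using hr

end Powers


/-! ### Test ideals: stabilization, right continuity and formal properties. -/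

section TestIdealChain

theorem natCeil_mul_pow_add_le (p : ℕ) (t : ℝ) (e f : ℕ) :
    ⌈t * (p : ℝ) ^ (e + f)⌉₊ ≤ ⌈t * (p : ℝ) ^ e⌉₊ * p ^ f := by
  rw [Nat.ceil_le]
  push_cast
  rw [pow_add, ← mul_assoc]
  gcongr
  exact Nat.le_ceil _

variable {p : ℕ} {R : Type*} [CommRing R]

theorem HasFrobeniusBasis.rootIdeal_pow_le {e : ℕ} (h : HasFrobeniusBasis (p ^ e) R)
    (𝔞 : Ideal R) (n : ℕ) : rootIdeal p e (𝔞 ^ n) ≤ rootIdeal p e 𝔞 ^ n := by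
  induction n with
  | zero => simp
  | succ n ih =>
    rw [pow_succ, pow_succ]
    exact (h.rootIdeal_mul_le _ _).trans (Ideal.mul_mono_left ih)

/-- The test ideal as the supremum of the ideals `(𝔞^{⌈t p^e⌉})^{[1/p^e]}`. -/
theorem testIdeal_eq_iSup (𝔞 : Ideal R) (t : ℝ) :
    testIdeal p 𝔞 t = ⨆ e, rootIdeal p e (𝔞 ^ ⌈t * (p : ℝ) ^ e⌉₊) := by
  apply le_antisymm
  · refine iSup_le fun e => iSup_le fun f => ?_
    -- The inner union is redundant: its `(e, f)` term lies in the diagonal term at `e + f`.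
    refine le_trans ?_ (le_iSup _ (e + f))
    exact rootIdeal_mono (Ideal.pow_le_pow_right (natCeil_mul_pow_add_le p t e f))
  · refine iSup_le fun e => le_trans ?_ (le_iSup _ e)
    refine le_trans ?_ (le_iSup _ 0)
    simp

theorem rootIdeal_le_testIdeal (𝔞 : Ideal R) {t : ℝ} {e n : ℕ} (h : t * (p : ℝ) ^ e ≤ n) :
    rootIdeal p e (𝔞 ^ n) ≤ testIdeal p 𝔞 t := by
  rw [testIdeal_eq_iSup]
  refine le_trans ?_ (le_iSup _ e)
  exact rootIdeal_mono (Ideal.pow_le_pow_right (Nat.ceil_le.2 h))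

theorem testIdeal_mono_left {𝔞 𝔟 : Ideal R} (h : 𝔞 ≤ 𝔟) (t : ℝ) :
    testIdeal p 𝔞 t ≤ testIdeal p 𝔟 t := by
  rw [testIdeal_eq_iSup, testIdeal_eq_iSup]
  exact iSup_mono fun e => rootIdeal_mono (Ideal.pow_right_mono h _)

theorem testIdeal_anti_right (𝔞 : Ideal R) {t t' : ℝ} (h : t' ≤ t) :
    testIdeal p 𝔞 t ≤ testIdeal p 𝔞 t' := by
  conv_lhs => rw [testIdeal_eq_iSup]
  refine iSup_le fun e => rootIdeal_le_testIdeal 𝔞 ?_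
  exact le_trans (by gcongr) (Nat.le_ceil _)

theorem testIdeal_zero (𝔞 : Ideal R) : testIdeal p 𝔞 0 = ⊤ := by
  rw [eq_top_iff]
  refine le_trans ?_ (rootIdeal_le_testIdeal (e := 0) (n := 0) 𝔞 (by simp))
  simpa using le_rootIdeal_zero p (⊤ : Ideal R)

theorem le_testIdeal_one (𝔞 : Ideal R) : 𝔞 ≤ testIdeal p 𝔞 1 := by
  refine le_trans ?_ (rootIdeal_le_testIdeal (e := 0) (n := 1) 𝔞 (by simp))
  simpa using le_rootIdeal_zero p 𝔞

variable [Fact p.Prime]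

/-- The Briançon–Skoda theorem for test ideals. -/
theorem testIdeal_span_range_eq_mul {r : ℕ} (g : Fin r → R) {ℓ : ℕ}
    (hℓ : 1 ≤ ℓ) (hr : r ≤ ℓ) :
    testIdeal p (Ideal.span (Set.range g)) ℓ =
      Ideal.span (Set.range g) * testIdeal p (Ideal.span (Set.range g)) ((ℓ : ℝ) - 1) := by
  set 𝔞 := Ideal.span (Set.range g)
  have h1 : ∀ e : ℕ, ⌈(ℓ : ℝ) * (p : ℝ) ^ e⌉₊ = ℓ * p ^ e := fun e => by
    exact_mod_cast Nat.ceil_natCast (R := ℝ) (ℓ * p ^ e)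
  have h2 : ∀ e : ℕ, ⌈((ℓ : ℝ) - 1) * (p : ℝ) ^ e⌉₊ = (ℓ - 1) * p ^ e := fun e => by
    have := Nat.ceil_natCast (R := ℝ) ((ℓ - 1) * p ^ e)
    rwa [Nat.cast_mul, Nat.cast_pow, Nat.cast_sub hℓ, Nat.cast_one] at this
  rw [testIdeal_eq_iSup, testIdeal_eq_iSup, Ideal.mul_iSup]
  refine iSup_congr fun e => ?_
  rw [h1, h2]
  have hq : 0 < p ^ e := pow_pos (Fact.out : p.Prime).pos e
  have hsub : ℓ * p ^ e - p ^ e = (ℓ - 1) * p ^ e := by rw [Nat.sub_mul, one_mul]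
  have hadd : p ^ e + (ℓ - 1) * p ^ e = ℓ * p ^ e := by
    rw [← hsub, Nat.add_sub_cancel' (Nat.le_mul_of_pos_left _ hℓ)]
  apply le_antisymm
  · refine le_trans (rootIdeal_mono ?_) (rootIdeal_span_pow_mul_le g _)
    rw [← hsub]
    refine span_range_pow_le g ?_
    calc r * (p ^ e - 1) ≤ ℓ * (p ^ e - 1) := Nat.mul_le_mul_right _ hr
      _ < ℓ * p ^ e := Nat.mul_lt_mul_of_pos_left (by omega) hℓ
  · refine mul_rootIdeal_le fun y hy z hz => ?_
    rw [← hadd, pow_add]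
    exact Ideal.mul_mem_mul (Ideal.pow_mem_pow hy _) hz

theorem HasFrobeniusBasis.monotone_rootIdeal_ceil (hB : HasFrobeniusBasis p R) (𝔞 : Ideal R)
    (t : ℝ) : Monotone fun e => rootIdeal p e (𝔞 ^ ⌈t * (p : ℝ) ^ e⌉₊) := by
  refine monotone_nat_of_le_succ fun e => ?_
  refine hB.rootIdeal_le_succ (Fact.out : p.Prime).ne_zero fun y hy => ?_
  refine Ideal.pow_le_pow_right (natCeil_mul_pow_add_le p t e 1) ?_
  rw [pow_one, pow_mul]
  exact Ideal.pow_mem_pow hy _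

theorem HasFrobeniusBasis.testIdeal_le_of_eventually (hB : HasFrobeniusBasis p R) {𝔞 J : Ideal R}
    {t : ℝ} (h : ∀ᶠ e : ℕ in Filter.atTop, rootIdeal p e (𝔞 ^ ⌈t * (p : ℝ) ^ e⌉₊) ≤ J) :
    testIdeal p 𝔞 t ≤ J := by
  obtain ⟨N, hN⟩ := Filter.eventually_atTop.1 h
  rw [testIdeal_eq_iSup]
  exact iSup_le fun e => (hB.monotone_rootIdeal_ceil 𝔞 t (Nat.le_add_right e N)).trans
    (hN _ (Nat.le_add_left N e))

theorem HasFrobeniusBasis.exists_testIdeal_eq [IsNoetherianRing R] (hB : HasFrobeniusBasis p R)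
    (𝔞 : Ideal R) (t : ℝ) :
    ∃ e, testIdeal p 𝔞 t = rootIdeal p e (𝔞 ^ ⌈t * (p : ℝ) ^ e⌉₊) := by
  obtain ⟨e, he⟩ := monotone_stabilizes_iff_noetherian.2 (inferInstanceAs (IsNoetherian R R))
    ⟨_, hB.monotone_rootIdeal_ceil 𝔞 t⟩
  refine ⟨e, le_antisymm (hB.testIdeal_le_of_eventually ?_)
    (rootIdeal_le_testIdeal 𝔞 (Nat.le_ceil _))⟩
  filter_upwards [Filter.eventually_ge_atTop e] with m hm
  exact (he m hm).ge

variable [CharP R p]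

/-- If `𝔞 ⊆ ⋂ K^{p^f}` with `K = (I : u)` and `u ∈ 𝔞`, Krull's intersection theorem puts `u`
in `I`. -/
theorem HasFrobeniusBasis.rootIdeal_le_iSup [IsNoetherianRing R] (hB : HasFrobeniusBasis p R)
    (𝔞 : Ideal R) (e : ℕ) {r : ℕ} (hr : 0 < r) :
    rootIdeal p e (𝔞 ^ r) ≤ ⨆ f, rootIdeal p (e + f) (𝔞 ^ (r * p ^ f + 1)) := by
  set J := ⨆ f, rootIdeal p (e + f) (𝔞 ^ (r * p ^ f + 1)) with hJ
  rw [rootIdeal_le_iff_le_frobeniusPower]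
  intro u hu
  set I := frobeniusPower (p ^ e) J
  let K : Ideal R := Submodule.comap (LinearMap.mulLeft R u) I
  -- By `mem_pow` it suffices that `u * ψ v ∈ I`, and `φ (u * ψ v) = φ (ψ (u ^ p ^ f * v))`. The
  -- factor `v` accounts for the `+ 1` in the exponent.
  have hK : ∀ f, 𝔞 ≤ K ^ p ^ f := by
    intro f v hv
    refine (hB.pow f).mem_pow fun ψ hψ => ?_
    change u * ψ v ∈ I
    intro φ hφ
    rw [← hψ]
    have hlin : IsRootLinear (p ^ (e + f)) (φ.comp ψ) := by
      rw [pow_add]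
      exact hφ.comp hψ
    have hmem : u ^ p ^ f * v ∈ 𝔞 ^ (r * p ^ f + 1) := by
      rw [pow_succ, pow_mul]
      exact Ideal.mul_mem_mul (Ideal.pow_mem_pow hu _) hv
    exact (le_iSup (fun f => rootIdeal p (e + f) (𝔞 ^ (r * p ^ f + 1))) f)
      (mem_rootIdeal hlin hmem)
  have hu' : u ∈ (⨅ i : ℕ, K ^ i • ⊤ : Submodule R R) := by
    refine Submodule.mem_iInf _ |>.2 fun i => ?_
    rw [smul_eq_mul, Ideal.mul_top]
    exact Ideal.pow_le_pow_right (Nat.lt_pow_self (Fact.out : p.Prime).one_lt).le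
      (hK i (Ideal.pow_le_self hr.ne' hu))
  -- Krull's theorem in a Noetherian ring, not necessarily local, gives `k ∈ K` with `k * u = u`;
  -- but `k ∈ K` says `u * k ∈ I`.
  obtain ⟨k, hk⟩ := (Ideal.mem_iInf_smul_pow_eq_bot_iff K u).1 hu'
  rw [← hk, smul_eq_mul, mul_comm]
  exact k.2

/-- Right continuity of the test ideals in the exponent. -/
theorem HasFrobeniusBasis.exists_gt_testIdeal_le [IsNoetherianRing R]
    (hB : HasFrobeniusBasis p R) (𝔞 : Ideal R) {t : ℝ} (ht : 0 < t) :
    ∃ s, t < s ∧ testIdeal p 𝔞 t ≤ testIdeal p 𝔞 s := by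
  have hp : (0 : ℝ) < p := Nat.cast_pos.2 (Fact.out : p.Prime).pos
  obtain ⟨e, he⟩ := hB.exists_testIdeal_eq 𝔞 t
  set r := ⌈t * (p : ℝ) ^ e⌉₊ with hr
  have hr0 : 0 < r := Nat.ceil_pos.2 (by positivity)
  have hmono : Monotone fun f => rootIdeal p (e + f) (𝔞 ^ (r * p ^ f + 1)) := by
    refine monotone_nat_of_le_succ fun f => ?_
    refine hB.rootIdeal_le_succ (Fact.out : p.Prime).ne_zero fun y hy => ?_
    have h1 := Ideal.pow_mem_pow hy p
    rw [← pow_mul] at h1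
    refine Ideal.pow_le_pow_right ?_ h1
    rw [add_mul, one_mul, pow_succ, mul_assoc]
    exact Nat.add_le_add_left (Fact.out : p.Prime).one_le _
  obtain ⟨f, hf⟩ := monotone_stabilizes_iff_noetherian.2 (inferInstanceAs (IsNoetherian R R))
    ⟨_, hmono⟩
  have hsup : (⨆ f, rootIdeal p (e + f) (𝔞 ^ (r * p ^ f + 1))) ≤
      rootIdeal p (e + f) (𝔞 ^ (r * p ^ f + 1)) := by
    refine iSup_le fun g => (hmono (le_max_left g f)).trans ?_
    exact (hf _ (le_max_right g f)).ge
  -- The extra `1` makes this exceed `r / p ^ e`, which is already at least `t`.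
  refine ⟨((r * p ^ f + 1 : ℕ) : ℝ) / (p : ℝ) ^ (e + f), ?_, ?_⟩
  · rw [lt_div_iff₀ (by positivity), pow_add, ← mul_assoc]
    push_cast
    refine lt_of_le_of_lt (mul_le_mul_of_nonneg_right (Nat.le_ceil _) (by positivity)) ?_
    exact lt_add_one _
  · rw [he]
    refine (hB.rootIdeal_le_iSup 𝔞 e hr0).trans (hsup.trans (rootIdeal_le_testIdeal 𝔞 ?_))
    rw [div_mul_cancel₀ _ (by positivity)]

/-- Rounding costs at most `m`, so the total error is at most `m + k`, while `(s - t) p^e` tends to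
infinity. -/
theorem eventually_add_le_ceil {s t : ℝ} (ht : 0 ≤ t) (hst : t < s) (m k : ℕ) (hm : 0 < m) :
    ∀ᶠ e : ℕ in Filter.atTop,
      m * ⌈t / m * (p : ℝ) ^ e⌉₊ + k ≤ ⌈s * (p : ℝ) ^ e⌉₊ := by
  have hp : (1 : ℝ) < p := by exact_mod_cast (Fact.out : p.Prime).one_lt
  have h := (tendsto_pow_atTop_atTop_of_one_lt hp).eventually_ge_atTop ((m + k) / (s - t))
  filter_upwards [h] with e he
  rw [div_le_iff₀ (sub_pos.2 hst)] at he
  have h1 := (Nat.ceil_lt_add_one (show 0 ≤ t / m * (p : ℝ) ^ e by positivity)).le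
  have hm' : (0 : ℝ) < m := by exact_mod_cast hm
  have h2 : (m : ℝ) * ⌈t / m * (p : ℝ) ^ e⌉₊ ≤ t * (p : ℝ) ^ e + m := by
    refine (mul_le_mul_of_nonneg_left h1 hm'.le).trans (le_of_eq ?_)
    field_simp
  have h3 : ((m * ⌈t / m * (p : ℝ) ^ e⌉₊ + k : ℕ) : ℝ) ≤ (⌈s * (p : ℝ) ^ e⌉₊ : ℝ) := by
    refine le_trans ?_ (Nat.le_ceil _)
    push_cast
    linarith
  exact_mod_cast h3

theorem HasFrobeniusBasis.testIdeal_pow [IsNoetherianRing R] (hB : HasFrobeniusBasis p R)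
    (𝔞 : Ideal R) {n : ℕ} (hn : 0 < n) {t : ℝ} (ht : 0 < t) :
    testIdeal p (𝔞 ^ n) t = testIdeal p 𝔞 (n * t) := by
  have hn' : (0 : ℝ) < n := by exact_mod_cast hn
  apply le_antisymm
  · conv_lhs => rw [testIdeal_eq_iSup]
    refine iSup_le fun e => ?_
    rw [← pow_mul]
    refine rootIdeal_le_testIdeal 𝔞 ?_
    push_cast
    rw [mul_assoc]
    exact mul_le_mul_of_nonneg_left (Nat.le_ceil _) hn'.le
  -- `n * ⌈t p^e⌉` may exceed `⌈n t p^e⌉`; passing to `s > n * t` repairs this for large `e`.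
  · obtain ⟨s, hs, hle⟩ := hB.exists_gt_testIdeal_le 𝔞 (mul_pos hn' ht)
    refine hle.trans (hB.testIdeal_le_of_eventually ?_)
    filter_upwards [eventually_add_le_ceil (p := p) (mul_pos hn' ht).le hs n 0 hn] with e he
    rw [mul_div_cancel_left₀ _ hn'.ne', add_zero] at he
    refine (rootIdeal_mono (Ideal.pow_le_pow_right he)).trans ?_
    rw [pow_mul]
    exact rootIdeal_le_testIdeal _ (Nat.le_ceil _)

theorem HasFrobeniusBasis.testIdeal_idealIntegralClosure [IsNoetherianRing R]
    (hB : HasFrobeniusBasis p R) (𝔞 : Ideal R) {t : ℝ} (ht : 0 ≤ t) :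
    testIdeal p (idealIntegralClosure 𝔞) t = testIdeal p 𝔞 t := by
  refine le_antisymm ?_ (testIdeal_mono_left (le_idealIntegralClosure 𝔞) t)
  rcases ht.eq_or_lt with rfl | ht
  · simp [testIdeal_zero]
  obtain ⟨s, hs, hle⟩ := hB.exists_gt_testIdeal_le (idealIntegralClosure 𝔞) ht
  obtain ⟨k, hk⟩ := exists_idealIntegralClosure_pow_le 𝔞
  refine hle.trans (hB.testIdeal_le_of_eventually ?_)
  filter_upwards [eventually_add_le_ceil (p := p) ht.le hs 1 k one_pos] with e he
  rw [Nat.cast_one, div_one, one_mul] at he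
  refine (rootIdeal_mono ((hk _).trans (Ideal.pow_le_pow_right (Nat.le_sub_of_add_le he)))).trans ?_
  exact rootIdeal_le_testIdeal _ (Nat.le_ceil _)

theorem HasFrobeniusBasis.testIdeal_map_le (hB : HasFrobeniusBasis p R) {S : Type*} [CommRing S]
    (f : R →+* S) (𝔞 : Ideal R) (t : ℝ) :
    testIdeal p (𝔞.map f) t ≤ (testIdeal p 𝔞 t).map f := by
  conv_lhs => rw [testIdeal_eq_iSup]
  refine iSup_le fun e => ?_
  rw [← Ideal.map_pow]
  exact ((hB.pow e).rootIdeal_map_le f _).trans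
    (Ideal.map_mono (rootIdeal_le_testIdeal _ (Nat.le_ceil _)))

theorem HasFrobeniusBasis.map_testIdeal (hB : HasFrobeniusBasis p R) (W : Submonoid R)
    {S : Type*} [CommRing S] [Algebra R S] [IsLocalization W S] (𝔞 : Ideal R) (t : ℝ) :
    (testIdeal p 𝔞 t).map (algebraMap R S) = testIdeal p (𝔞.map (algebraMap R S)) t := by
  refine le_antisymm ?_ (hB.testIdeal_map_le _ _ _)
  rw [testIdeal_eq_iSup, testIdeal_eq_iSup, Ideal.map_iSup]
  refine iSup_mono fun e => ?_
  rw [← Ideal.map_pow]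
  exact map_rootIdeal_le W (Fact.out : p.Prime).ne_zero _

theorem HasFrobeniusBasis.testIdeal_mul_le_pow [IsNoetherianRing R] (hB : HasFrobeniusBasis p R)
    (𝔞 : Ideal R) {t : ℝ} (ht : 0 ≤ t) (n : ℕ) :
    testIdeal p 𝔞 (t * n) ≤ testIdeal p 𝔞 t ^ n := by
  rcases ht.eq_or_lt with rfl | ht
  · simp [testIdeal_zero, Ideal.top_pow]
  rcases Nat.eq_zero_or_pos n with rfl | hn
  · simp
  -- The exponent becomes exactly `n * ⌈t p^e⌉`, so submultiplicativity applies with no rounding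
  -- loss.
  rw [mul_comm, ← hB.testIdeal_pow 𝔞 hn ht]
  conv_lhs => rw [testIdeal_eq_iSup]
  refine iSup_le fun e => ?_
  rw [← pow_mul, mul_comm, pow_mul]
  exact ((hB.pow e).rootIdeal_pow_le _ n).trans
    (Ideal.pow_right_mono (rootIdeal_le_testIdeal _ (Nat.le_ceil _)) n)

theorem HasFrobeniusBasis.mixedTestIdeal_le (hB : HasFrobeniusBasis p R) (𝔞 𝔟 : Ideal R)
    (t s : ℝ) : mixedTestIdeal p 𝔞 𝔟 t s ≤ testIdeal p 𝔞 t * testIdeal p 𝔟 s :=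
  iSup_le fun e => ((hB.pow e).rootIdeal_mul_le _ _).trans
    (Ideal.mul_mono (rootIdeal_le_testIdeal _ (Nat.le_ceil _))
      (rootIdeal_le_testIdeal _ (Nat.le_ceil _)))

end TestIdealChain


/-! ### Weakly regular sequences and their powers. -/

section WeaklyRegular

open RingTheory.Sequence Pointwise

universe v

variable {R : Type*} [CommRing R]

/-- Regularity of `r` on `C` keeps the short exact sequence exact on the left after reduction modulo
`r`. -/
theorem isWeaklyRegular_of_exact {rs : List R} {A B C : Type v} [AddCommGroup A] [AddCommGroup B]
    [AddCommGroup C] [Module R A] [Module R B] [Module R C] {f : A →ₗ[R] B} {g : B →ₗ[R] C}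
    (hf : Function.Injective f) (hfg : Function.Exact f g) (hg : Function.Surjective g)
    (hA : IsWeaklyRegular A rs) (hC : IsWeaklyRegular C rs) : IsWeaklyRegular B rs := by
  induction rs generalizing A B C with
  | nil => simp
  | cons r rs ih =>
    rw [isWeaklyRegular_cons_iff] at hA hC ⊢
    refine ⟨isSMulRegular_of_range_eq_ker hf hfg.linearMap_ker_eq.symm hA.1 hC.1,
      ih (f := QuotSMulTop.map r f) (g := QuotSMulTop.map r g) ?_
        (QuotSMulTop.map_exact r hfg hg) (QuotSMulTop.map_surjective r hg) hA.2 hC.2⟩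
    have h0 : Function.Exact (0 : A →ₗ[R] A) f := by
      rw [LinearMap.exact_iff, LinearMap.range_zero, LinearMap.ker_eq_bot.2 hf]
    have h1 := QuotSMulTop.map_first_exact_on_four_term_exact_of_isSMulRegular_last h0 hfg hC.1
    rw [LinearMap.exact_iff, map_zero, LinearMap.range_zero] at h1
    exact LinearMap.ker_eq_bot.1 h1

/-- Induct along `0 → M/x^(k+1) → M/x^(k+2) → M/x → 0`, where the first map is multiplication by
`x`. -/
theorem isWeaklyRegular_quotSMulTop_pow {M : Type v} [AddCommGroup M] [Module R M] {x : R}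
    (hx : IsSMulRegular M x) {rs : List R} (h : IsWeaklyRegular (QuotSMulTop x M) rs) (k : ℕ) :
    IsWeaklyRegular (QuotSMulTop (x ^ (k + 1)) M) rs := by
  induction k with
  | zero =>
    have h1 : x = x ^ (0 + 1) := by simp
    exact h1 ▸ h
  | succ k ih =>
    have hle : x ^ (k + 1) • (⊤ : Submodule R M) ≤
        (x ^ (k + 1 + 1) • (⊤ : Submodule R M)).comap (LinearMap.lsmul R M x) := by
      intro m hm
      obtain ⟨n, -, rfl⟩ := (Submodule.mem_smul_pointwise_iff_exists _ _ _).1 hm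
      refine (Submodule.mem_smul_pointwise_iff_exists _ _ _).2 ⟨n, trivial, ?_⟩
      simp only [LinearMap.lsmul_apply, smul_smul, pow_succ']
    have hle' : x ^ (k + 1 + 1) • (⊤ : Submodule R M) ≤ x • (⊤ : Submodule R M) := by
      intro m hm
      obtain ⟨n, -, rfl⟩ := (Submodule.mem_smul_pointwise_iff_exists _ _ _).1 hm
      refine (Submodule.mem_smul_pointwise_iff_exists _ _ _).2 ⟨x ^ (k + 1) • n, trivial, ?_⟩
      rw [smul_smul, ← pow_succ']
    refine isWeaklyRegular_of_exact
      (f := Submodule.mapQ (x ^ (k + 1) • ⊤) (x ^ (k + 1 + 1) • ⊤) (LinearMap.lsmul R M x) hle)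
      (g := Submodule.factor hle') ?_ ?_ (Submodule.factor_surjective hle') ih h
    · rw [injective_iff_map_eq_zero]
      intro a ha
      obtain ⟨m, rfl⟩ := Submodule.Quotient.mk_surjective _ a
      rw [Submodule.mapQ_apply, Submodule.Quotient.mk_eq_zero] at ha
      rw [Submodule.Quotient.mk_eq_zero]
      obtain ⟨n, -, hn⟩ := (Submodule.mem_smul_pointwise_iff_exists _ _ _).1 ha
      refine (Submodule.mem_smul_pointwise_iff_exists _ _ _).2 ⟨n, trivial, hx ?_⟩
      rw [LinearMap.lsmul_apply, pow_succ', mul_smul] at hn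
      exact hn
    · intro b
      obtain ⟨m, rfl⟩ := Submodule.Quotient.mk_surjective _ b
      constructor
      · intro hb
        change Submodule.Quotient.mk m = 0 at hb
        rw [Submodule.Quotient.mk_eq_zero] at hb
        obtain ⟨n, -, hn⟩ := (Submodule.mem_smul_pointwise_iff_exists _ _ _).1 hb
        exact ⟨Submodule.Quotient.mk n, by rw [Submodule.mapQ_apply, LinearMap.lsmul_apply, hn]⟩
      · rintro ⟨a, ha⟩
        obtain ⟨n, rfl⟩ := Submodule.Quotient.mk_surjective _ a
        rw [← ha, Submodule.mapQ_apply]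
        change Submodule.Quotient.mk _ = 0
        rw [Submodule.Quotient.mk_eq_zero]
        exact Submodule.smul_mem_pointwise_smul _ _ _ trivial

theorem IsWeaklyRegular.map_pow {M : Type v} [AddCommGroup M] [Module R M] {rs : List R}
    (h : IsWeaklyRegular M rs) {k : ℕ} (hk : 0 < k) : IsWeaklyRegular M (rs.map (· ^ k)) := by
  obtain ⟨k, rfl⟩ := Nat.exists_eq_succ_of_ne_zero hk.ne'
  induction rs generalizing M with
  | nil => simp
  | cons r rs ih =>
    rw [isWeaklyRegular_cons_iff] at h
    rw [List.map_cons, isWeaklyRegular_cons_iff]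
    exact ⟨h.1.pow _, ih (isWeaklyRegular_quotSMulTop_pow h.1 h.2 k)⟩

end WeaklyRegular

/-! ### Regular local rings. -/

section RegularLocal

open RingTheory.Sequence IsLocalRing

universe u v

/-- Over a field every module is free. Otherwise, `M / xM` is free over `R / (x)` by induction, and
freeness lifts because `x` is regular on `M`. -/
theorem free_of_isWeaklyRegular (n : ℕ) (R : Type u) [CommRing R] [IsLocalRing R]
    [IsNoetherianRing R] (M : Type v) [AddCommGroup M] [Module R M] [Module.Finite R M]
    (rs : List R) (hn : rs.length = n) (hrs : Ideal.ofList rs = maximalIdeal R)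
    (h : IsWeaklyRegular M rs) : Module.Free R M := by
  induction n generalizing R M with
  | zero =>
    obtain rfl := List.length_eq_zero_iff.1 hn
    rw [Ideal.ofList_nil] at hrs
    let := (isField_iff_maximalIdeal_eq.2 hrs.symm).toField
    exact Module.Free.of_divisionRing R M
  | succ n ih =>
    obtain ⟨x, rs, rfl⟩ := List.exists_cons_of_ne_nil (List.ne_nil_of_length_eq_add_one hn)
    have hx : x ∈ maximalIdeal R := by
      rw [← hrs, Ideal.ofList_cons]
      exact Ideal.mem_sup_left (Ideal.mem_span_singleton_self x)
    rw [isWeaklyRegular_cons_iff'] at h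
    have hne : Ideal.span {x} ≠ ⊤ := ne_top_of_le_ne_top (maximalIdeal.isMaximal R).ne_top
      ((Ideal.span_singleton_le_iff_mem _).2 hx)
    have := Ideal.Quotient.nontrivial_iff.2 hne
    have : IsLocalRing (R ⧸ Ideal.span {x}) :=
      IsLocalRing.of_surjective' (Ideal.Quotient.mk _) Ideal.Quotient.mk_surjective
    have := Module.Finite.of_restrictScalars_finite R (R ⧸ Ideal.span {x}) (QuotSMulTop x M)
    have hfree := ih (R ⧸ Ideal.span {x}) (QuotSMulTop x M) (rs.map (Ideal.Quotient.mk _))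
      (by simpa using hn) ?_ h.2
    · have : Module.FinitePresentation R M := Module.finitePresentation_of_finite R M
      refine (Module.free_quotSMulTop_iff_free R M ?_ h.1).1 hfree
      rwa [jacobson_eq_maximalIdeal ⊥ bot_ne_top]
    · rw [← map_maximalIdeal_of_surjective (Ideal.Quotient.mk (Ideal.span {x}))
        Ideal.Quotient.mk_surjective, ← hrs, Ideal.ofList_cons, Ideal.map_sup,
        Ideal.map_quotient_self, bot_sup_eq, Ideal.map_ofList]

/-- As `x` is not in the square of the maximal ideal, some coefficient of `x` in a minimal
generating set is a unit; that generator is redundant modulo `x`. -/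
theorem spanFinrank_maximalIdeal_quotient_lt {R : Type u} [CommRing R] [IsLocalRing R]
    [IsNoetherianRing R] {x : R} (hx : x ∈ maximalIdeal R) (hx2 : x ∉ maximalIdeal R ^ 2)
    [IsLocalRing (R ⧸ Ideal.span {x})] :
    (maximalIdeal (R ⧸ Ideal.span {x})).spanFinrank < (maximalIdeal R).spanFinrank := by
  classical
  obtain ⟨s, hs, hspan⟩ := Submodule.FG.exists_span_finset_card_eq_spanFinrank
    (maximalIdeal R).fg_of_isNoetherianRing
  have hsm : ∀ a ∈ s, a ∈ maximalIdeal R := fun a ha => hspan ▸ Submodule.subset_span ha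
  rw [← hspan] at hx
  obtain ⟨c, -, hc⟩ := Submodule.mem_span_finset.1 hx
  obtain ⟨j, hj, hcj⟩ : ∃ j ∈ s, IsUnit (c j) := by
    by_contra! hcon
    refine hx2 ?_
    rw [← hc, pow_two]
    exact Ideal.sum_mem _ fun a ha => Ideal.mul_mem_mul (hcon a ha) (hsm a ha)
  rw [← hs, ← map_maximalIdeal_of_surjective (Ideal.Quotient.mk (Ideal.span {x}))
    Ideal.Quotient.mk_surjective]
  have key : (maximalIdeal R).map (Ideal.Quotient.mk (Ideal.span {x})) =
      Submodule.span _ (((s.erase j).image (Ideal.Quotient.mk (Ideal.span {x})) : Finset _) :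
        Set (R ⧸ Ideal.span {x})) := by
    rw [← hspan]
    change Ideal.map _ (Ideal.span _) = Ideal.span _
    rw [Ideal.map_span]
    apply le_antisymm
    · rw [Ideal.span_le]
      rintro _ ⟨a, ha, rfl⟩
      have hmem : ∀ b ∈ s.erase j, Ideal.Quotient.mk (Ideal.span {x}) b ∈
          Ideal.span (((s.erase j).image (Ideal.Quotient.mk (Ideal.span {x})) : Finset _) :
            Set (R ⧸ Ideal.span {x})) :=
        fun b hb => Ideal.subset_span (Finset.mem_coe.2 (Finset.mem_image_of_mem _ hb))
      by_cases haj : a = j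
      · subst haj
        have h0 : Ideal.Quotient.mk (Ideal.span {x}) (∑ b ∈ s, c b • b) = 0 := by
          rw [hc]
          exact Ideal.Quotient.eq_zero_iff_mem.2 (Ideal.mem_span_singleton_self x)
        rw [← Finset.add_sum_erase s _ hj, map_add, smul_eq_mul, map_mul, map_sum] at h0
        refine (Ideal.unit_mul_mem_iff_mem _ (hcj.map (Ideal.Quotient.mk (Ideal.span {x})))).1 ?_
        rw [eq_neg_of_add_eq_zero_left h0]
        refine neg_mem (Ideal.sum_mem _ fun b hb => ?_)
        rw [smul_eq_mul, map_mul]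
        exact Ideal.mul_mem_left _ _ (hmem b hb)
      · exact hmem a (Finset.mem_erase.2 ⟨haj, ha⟩)
    · refine Ideal.span_mono ?_
      rw [Finset.coe_image]
      exact Set.image_mono (Finset.erase_subset j s)
  rw [key]
  refine (Submodule.spanFinrank_span_le_ncard_of_finite (Finset.finite_toSet _)).trans_lt ?_
  rw [Set.ncard_coe_finset]
  exact Finset.card_image_le.trans_lt (Finset.card_erase_lt_of_mem hj)

/-- The embedding dimension drops by at least one and the Krull dimension by at most one, so the two
stay equal. -/
theorem isRegularLocalRing_quotient {R : Type u} [CommRing R] [IsRegularLocalRing R]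
    {x : R} (hx : x ∈ maximalIdeal R) (hx2 : x ∉ maximalIdeal R ^ 2) :
    ∃ _ : IsRegularLocalRing (R ⧸ Ideal.span {x}),
      (maximalIdeal (R ⧸ Ideal.span {x})).spanFinrank + 1 = (maximalIdeal R).spanFinrank := by
  have hne : Ideal.span {x} ≠ ⊤ := ne_top_of_le_ne_top (maximalIdeal.isMaximal R).ne_top
    ((Ideal.span_singleton_le_iff_mem _).2 hx)
  have := Ideal.Quotient.nontrivial_iff.2 hne
  have : IsLocalRing (R ⧸ Ideal.span {x}) :=
    IsLocalRing.of_surjective' (Ideal.Quotient.mk _) Ideal.Quotient.mk_surjective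
  have hlt := spanFinrank_maximalIdeal_quotient_lt hx hx2
  have hdim : ringKrullDim R ≤ ringKrullDim (R ⧸ Ideal.span {x}) + 1 := by
    have := ringKrullDim_le_ringKrullDim_quotient_add_card {x}
      (by simpa [ringJacobson_eq_maximalIdeal] using hx)
    rwa [Finset.card_singleton, Finset.coe_singleton, Nat.cast_one] at this
  have h1 := (isRegularLocalRing_iff R).1 inferInstance
  have h2 := ringKrullDim_le_spanFinrank_maximalIdeal (R ⧸ Ideal.span {x})
  have h3 : ((maximalIdeal R).spanFinrank : WithBot ℕ∞) ≤
      (maximalIdeal (R ⧸ Ideal.span {x})).spanFinrank + 1 := by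
    rw [h1]
    exact hdim.trans (by gcongr)
  have h4 : (maximalIdeal R).spanFinrank ≤
      (maximalIdeal (R ⧸ Ideal.span {x})).spanFinrank + 1 := by exact_mod_cast h3
  refine ⟨IsRegularLocalRing.of_spanFinrank_maximalIdeal_le _ ?_, by omega⟩
  have h5 : ((maximalIdeal (R ⧸ Ideal.span {x})).spanFinrank : WithBot ℕ∞) + 1 ≤
      ringKrullDim (R ⧸ Ideal.span {x}) + 1 := by
    refine le_trans ?_ (h1.le.trans hdim)
    exact_mod_cast hlt
  exact ENat.WithBot.add_le_add_one_right_iff.1 h5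

/-- A regular local ring is a domain whose maximal ideal is generated by a regular sequence. -/
theorem isDomain_and_exists_isWeaklyRegular (n : ℕ) (R : Type u) [CommRing R]
    [IsRegularLocalRing R] (hn : (maximalIdeal R).spanFinrank = n) :
    IsDomain R ∧ ∃ rs : List R, Ideal.ofList rs = maximalIdeal R ∧ IsWeaklyRegular R rs := by
  induction n generalizing R with
  | zero =>
    rw [Submodule.spanFinrank_eq_zero_iff_eq_bot (maximalIdeal R).fg_of_isNoetherianRing] at hn
    exact ⟨(isField_iff_maximalIdeal_eq.2 hn).isDomain, [], by rw [hn, Ideal.ofList_nil], by simp⟩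
  | succ n ih =>
    -- Prime avoidance, which tolerates the non-prime ideal `maximalIdeal R ^ 2`.
    obtain ⟨x, hx, hx2, hxP⟩ : ∃ x ∈ maximalIdeal R, x ∉ maximalIdeal R ^ 2 ∧
        ∀ P ∈ minimalPrimes R, x ∉ P := by
      by_contra! hcon
      have hsub : (maximalIdeal R : Set R) ⊆
          ⋃ P ∈ insert (maximalIdeal R ^ 2) (minimalPrimes R), (P : Set R) := by
        intro x hx
        by_cases hx2 : x ∈ maximalIdeal R ^ 2
        · exact Set.mem_biUnion (Set.mem_insert _ _) hx2
        · obtain ⟨P, hP, hxP⟩ := hcon x hx hx2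
          exact Set.mem_biUnion (Set.mem_insert_of_mem _ hP) hxP
      obtain ⟨P, hP, hle⟩ := (Ideal.subset_union_prime_finite
        ((minimalPrimes.finite_of_isNoetherianRing R).insert _) (f := id)
        (maximalIdeal R ^ 2) (maximalIdeal R ^ 2) (fun P hP h1 _ =>
          ((Set.mem_insert_iff.1 hP).resolve_left h1).1.1)).1 hsub
      rcases Set.mem_insert_iff.1 hP with rfl | hP
      · have hbot : maximalIdeal R = ⊥ := by
          refine Submodule.eq_bot_of_le_smul_of_le_jacobson_bot (maximalIdeal R) _
            (maximalIdeal R).fg_of_isNoetherianRing ?_ (maximalIdeal_le_jacobson _)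
          rw [smul_eq_mul, ← pow_two]
          exact hle
        rw [(Submodule.spanFinrank_eq_zero_iff_eq_bot
          (maximalIdeal R).fg_of_isNoetherianRing).2 hbot] at hn
        omega
      · have hPm : P = maximalIdeal R := le_antisymm (le_maximalIdeal hP.1.1.ne_top) hle
        rw [hPm] at hP
        have h0 := Ideal.height_eq_zero_iff.2 hP
        have h1 := maximalIdeal_height_eq_ringKrullDim (R := R)
        rw [h0, ← (isRegularLocalRing_iff R).1 inferInstance, hn] at h1
        have h2 : (0 : ℕ) = n + 1 := by exact_mod_cast h1
        omega
    obtain ⟨hreg, hrank⟩ := isRegularLocalRing_quotient hx hx2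
    obtain ⟨hdom, rs', hrs', hw⟩ := ih (R ⧸ Ideal.span {x}) (by omega)
    obtain ⟨rs, rfl⟩ := Ideal.Quotient.mk_surjective.list_map rs'
    have hprime : (Ideal.span {x}).IsPrime := (Ideal.Quotient.isDomain_iff_prime _).1 hdom
    obtain ⟨P, hP, hPle⟩ := Ideal.exists_minimalPrimes_le (bot_le : ⊥ ≤ Ideal.span {x})
    have hPprime : P.IsPrime := hP.1.1
    -- Since `P ⊆ (x)` and `x ∉ P`, primality gives `P = xP`, and Nakayama gives `P = 0`.
    have hPbot : P = ⊥ := by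
      refine Submodule.eq_bot_of_le_smul_of_le_jacobson_bot (Ideal.span {x}) _
        P.fg_of_isNoetherianRing ?_
        (((Ideal.span_singleton_le_iff_mem _).2 hx).trans (maximalIdeal_le_jacobson _))
      intro y hy
      obtain ⟨z, rfl⟩ := Ideal.mem_span_singleton.1 (hPle hy)
      exact Ideal.mul_mem_mul (Ideal.mem_span_singleton_self x)
        ((hPprime.mem_or_mem hy).resolve_left (hxP P hP))
    have hx0 : x ≠ 0 := fun h => hxP P hP (h ▸ P.zero_mem)
    have hR : IsDomain R := by
      rw [hPbot] at hPprime
      exact IsDomain.of_bot_isPrime R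
    refine ⟨hR, x :: rs, ?_, IsWeaklyRegular.cons (fun a b hab => mul_left_cancel₀ hx0 hab) ?_⟩
    · rw [← Ideal.map_ofList, ← map_maximalIdeal_of_surjective (Ideal.Quotient.mk (Ideal.span {x}))
        Ideal.Quotient.mk_surjective] at hrs'
      have h := congrArg (Ideal.comap (Ideal.Quotient.mk (Ideal.span {x}))) hrs'
      rw [Ideal.comap_map_of_surjective _ Ideal.Quotient.mk_surjective,
        Ideal.comap_map_of_surjective _ Ideal.Quotient.mk_surjective, ← RingHom.ker_eq_comap_bot,
        Ideal.mk_ker, sup_eq_left.2 ((Ideal.span_singleton_le_iff_mem _).2 hx)] at h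
      rw [Ideal.ofList_cons, sup_comm, h]
    · have h := (isWeaklyRegular_map_algebraMap_iff (S := R ⧸ Ideal.span {x})
        (M := R ⧸ Ideal.span {x}) rs).1 hw
      refine (LinearEquiv.isWeaklyRegular_congr
        (Submodule.quotEquivOfEq (Ideal.span {x}) _ ?_) rs).1 h
      rw [← Submodule.ideal_span_singleton_smul, smul_eq_mul, Ideal.mul_top]

end RegularLocal


/-! ### Kunz's theorem: projectivity of the Frobenius pushforward. -/

section FrobeniusModule

open RingTheory.Sequence IsLocalRing

/-- The ring `R`, regarded as an algebra through the Frobenius map. -/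
@[nolint unusedArguments]
def FrobeniusPushforward (_p : ℕ) (R : Type*) : Type _ := R

instance (p : ℕ) (R : Type*) [CommRing R] : CommRing (FrobeniusPushforward p R) :=
  inferInstanceAs (CommRing R)

/-- The identity, from `R` to `R` regarded as an algebra through Frobenius. -/
def FrobeniusPushforward.of (p : ℕ) (R : Type*) [CommRing R] : R ≃+* FrobeniusPushforward p R :=
  RingEquiv.refl R

variable (p : ℕ) [Fact p.Prime]

noncomputable instance (A R : Type*) [CommRing A] [CommRing R] [Algebra A R] [CharP R p] :
    Algebra A (FrobeniusPushforward p R) :=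
  ((FrobeniusPushforward.of p R : R →+* FrobeniusPushforward p R).comp
    ((frobenius R p).comp (algebraMap A R))).toAlgebra

theorem FrobeniusPushforward.smul_of {A R : Type*} [CommRing A] [CommRing R] [Algebra A R]
    [CharP R p] (a : A) (x : R) : a • of p R x = of p R (algebraMap A R a ^ p * x) := by
  rw [Algebra.smul_def]
  rfl

instance (A B R : Type*) [CommRing A] [CommRing B] [CommRing R] [Algebra A B] [Algebra A R]
    [Algebra B R] [IsScalarTower A B R] [CharP R p] :
    IsScalarTower A B (FrobeniusPushforward p R) := by
  refine ⟨fun a b x => ?_⟩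
  obtain ⟨x, rfl⟩ := (FrobeniusPushforward.of p R).surjective x
  simp only [FrobeniusPushforward.smul_of]
  rw [Algebra.smul_def a b, map_mul (algebraMap B R), mul_pow, mul_assoc,
    ← IsScalarTower.algebraMap_apply]

theorem IsFFinite.finite {R : Type*} [CommRing R] [CharP R p] (h : IsFFinite p R) :
    Module.Finite R (FrobeniusPushforward p R) :=
  RingHom.finite_algebraMap.1
    (show (algebraMap R (FrobeniusPushforward p R)).Finite from h)

theorem free_frobeniusPushforward (R : Type*) [CommRing R] [IsRegularLocalRing R] [CharP R p]
    [Module.Finite R (FrobeniusPushforward p R)] :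
    Module.Free R (FrobeniusPushforward p R) := by
  obtain ⟨-, rs, hrs, h⟩ := isDomain_and_exists_isWeaklyRegular _ R rfl
  refine free_of_isWeaklyRegular _ R _ rs rfl hrs ?_
  -- Each `r` acts on the pushforward as `r ^ p` acts on `R`, so regularity of the powers on `R` is
  -- what is needed.
  refine (AddEquiv.isWeaklyRegular_congr (e := (FrobeniusPushforward.of p R).toAddEquiv)
    (as := rs.map (· ^ p)) ?_).1 (IsWeaklyRegular.map_pow h (Fact.out : p.Prime).pos)
  refine List.forall₂_map_left_iff.2 (List.forall₂_same.2 fun r _ x => ?_)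
  exact (FrobeniusPushforward.smul_of p r x).symm

/-- The localization map, as a linear map between the Frobenius pushforwards. -/
noncomputable def FrobeniusPushforward.map (R S : Type*) [CommRing R] [CommRing S] [Algebra R S]
    [CharP R p] [CharP S p] : FrobeniusPushforward p R →ₗ[R] FrobeniusPushforward p S where
  toFun x := of p S (algebraMap R S ((of p R).symm x))
  map_add' x y := by simp
  map_smul' r x := by
    obtain ⟨x, rfl⟩ := (of p R).surjective x
    simp [smul_of]

theorem FrobeniusPushforward.isLocalizedModule (R S : Type*) [CommRing R] [CommRing S]
    [Algebra R S] [CharP R p] [CharP S p] (W : Submonoid R) [IsLocalization W S] :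
    IsLocalizedModule W (FrobeniusPushforward.map p R S) where
  map_units w := by
    have h := (IsLocalization.map_units S w).map (Algebra.lsmul R R (FrobeniusPushforward p S))
    rwa [AlgHom.commutes] at h
  surj y := by
    obtain ⟨y, rfl⟩ := (of p S).surjective y
    obtain ⟨r, w, rfl⟩ := IsLocalization.exists_mk'_eq W y
    obtain ⟨m, hm⟩ := Nat.exists_eq_succ_of_ne_zero (Fact.out : p.Prime).ne_zero
    -- Acting by `w` multiplies by `w ^ p = w ^ (m + 1)`: one factor cancels the denominator and `w
    -- ^ m` remains.
    refine ⟨(of p R (r * (w : R) ^ m), w), ?_⟩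
    change (w : R) • of p S _ = of p S (algebraMap R S (r * (w : R) ^ m))
    have h : ∀ z : S, z ^ p = z ^ m * z := fun z => by rw [hm, Nat.succ_eq_add_one, pow_succ]
    rw [smul_of, h, mul_assoc, IsLocalization.mk'_spec', mul_comm,
      map_mul (algebraMap R S), map_pow (algebraMap R S)]
  exists_of_eq {x y} h := by
    obtain ⟨x, rfl⟩ := (of p R).surjective x
    obtain ⟨y, rfl⟩ := (of p R).surjective y
    obtain ⟨c, hc⟩ := (IsLocalization.eq_iff_exists W S).1
      (show algebraMap R S x = algebraMap R S y from h)
    obtain ⟨m, hm⟩ := Nat.exists_eq_succ_of_ne_zero (Fact.out : p.Prime).ne_zero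
    refine ⟨c, ?_⟩
    rw [Submonoid.smul_def, Submonoid.smul_def, smul_of, smul_of]
    refine congrArg (of p R) ?_
    rw [Algebra.algebraMap_self_apply, hm, pow_succ, mul_assoc, mul_assoc, hc]

/-- Over a regular ring the Frobenius pushforward is projective as soon as it is finite. -/
theorem projective_frobeniusPushforward (R : Type*) [CommRing R] [IsRegularRing R] [CharP R p]
    [Module.Finite R (FrobeniusPushforward p R)] :
    Module.Projective R (FrobeniusPushforward p R) := by
  have := Module.finitePresentation_of_finite R (FrobeniusPushforward p R)
  refine Module.projective_of_localization_maximal fun P hP => ?_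
  have : CharP (Localization.AtPrime P) p :=
    (CharP.charP_iff_prime_eq_zero (Fact.out : p.Prime)).2 (by
      rw [← map_natCast (algebraMap R (Localization.AtPrime P)), CharP.cast_eq_zero, map_zero])
  have := FrobeniusPushforward.isLocalizedModule p R (Localization.AtPrime P) P.primeCompl
  have := Module.Finite.of_isLocalizedModule P.primeCompl (Rₚ := Localization.AtPrime P)
    (FrobeniusPushforward.map p R (Localization.AtPrime P))
  have := free_frobeniusPushforward p (Localization.AtPrime P)
  exact Module.Projective.of_equiv ((IsLocalizedModule.linearEquiv P.primeCompl
    (FrobeniusPushforward.map p R (Localization.AtPrime P))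
    (LocalizedModule.mkLinearMap P.primeCompl (FrobeniusPushforward p R))
    ).extendScalarsOfIsLocalization P.primeCompl (Localization.AtPrime P))

/-- An F-finite regular ring has finite projective coordinates for `R^{1/p}` over `R`. -/
theorem IsFFinite.hasFrobeniusBasis {R : Type*} [CommRing R] [IsRegularRing R] [CharP R p]
    (h : IsFFinite p R) : HasFrobeniusBasis p R := by
  have := h.finite
  have := projective_frobeniusPushforward p R
  obtain ⟨n, f, g, -, -, hfg⟩ :=
    Module.Finite.exists_comp_eq_id_of_projective R (FrobeniusPushforward p R)
  let o := FrobeniusPushforward.of p R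
  -- Projectivity splits a surjection from `R^n`: the coordinates of the section `g` are the maps,
  -- the images of the standard basis the elements.
  refine ⟨Fin n, inferInstance,
    fun i => ((LinearMap.proj i).comp g).toAddMonoidHom.comp o.toAddMonoidHom,
    fun i => o.symm (f (Pi.single i 1)), fun i r x => ?_, fun y => ?_⟩
  · have h1 : o (r ^ p * x) = r • o x := (FrobeniusPushforward.smul_of p r x).symm
    change g (o (r ^ p * x)) i = r * g (o x) i
    rw [h1, map_smul, Pi.smul_apply, smul_eq_mul]
  · have h1 : f (g (o y)) = o y := LinearMap.congr_fun hfg (o y)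
    rw [← Finset.univ_sum_single (g (o y)), map_sum] at h1
    have h2 := congrArg o.symm h1
    rw [map_sum, RingEquiv.symm_apply_apply] at h2
    conv_lhs => rw [← h2]
    refine Finset.sum_congr rfl fun i _ => ?_
    have h3 : (Pi.single i (g (o y) i) : Fin n → R) = g (o y) i • Pi.single i 1 := by
      rw [← Pi.single_smul, smul_eq_mul, mul_one]
    rw [h3, map_smul]
    obtain ⟨z, hz⟩ := o.surjective (f (Pi.single i 1))
    rw [← hz, FrobeniusPushforward.smul_of, RingEquiv.symm_apply_apply,
      ← RingEquiv.symm_apply_apply o z, hz]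
    rfl

end FrobeniusModule

end TestIdeals

theorem mainTheorem4 (p : ℕ) [Fact p.Prime] (R : Type*) [CommRing R] [CharP R p]
    [IsRegularRing R] (hF : TestIdeals.IsFFinite p R) (𝔞 𝔟 : Ideal R) :
    -- (1) monotonicity in the ideal
    (𝔞 ≤ 𝔟 → ∀ t : ℝ, 0 < t → TestIdeals.testIdeal p 𝔞 t ≤ TestIdeals.testIdeal p 𝔟 t) ∧
    -- (2) monotonicity in the exponent
    (∀ t t' : ℝ, 0 ≤ t' → t' ≤ t →
      TestIdeals.testIdeal p 𝔞 t ≤ TestIdeals.testIdeal p 𝔞 t') ∧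
    -- (3) powers
    (∀ n : ℕ, 0 < n → ∀ t : ℝ, 0 < t →
      TestIdeals.testIdeal p (𝔞 ^ n) t = TestIdeals.testIdeal p 𝔞 (n * t)) ∧
    -- (4) localization
    (∀ (W : Submonoid R) (S : Type*) [CommRing S] [Algebra R S] [IsLocalization W S],
      ∀ t : ℝ, 0 ≤ t →
        (TestIdeals.testIdeal p 𝔞 t).map (algebraMap R S) =
          TestIdeals.testIdeal p (𝔞.map (algebraMap R S)) t) ∧
    -- (5) integral closure
    (∀ t : ℝ, 0 ≤ t →
      TestIdeals.testIdeal p (TestIdeals.idealIntegralClosure 𝔞) t =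
        TestIdeals.testIdeal p 𝔞 t) ∧
    -- (6) right continuity
    (∀ t : ℝ, 0 < t → ∃ ε : ℝ, 0 < ε ∧ ∀ t' ∈ Set.Ico t (t + ε),
      TestIdeals.testIdeal p 𝔞 t' = TestIdeals.testIdeal p 𝔞 t) ∧
    -- (7) the ideal lies in its test ideal
    𝔞 ≤ TestIdeals.testIdeal p 𝔞 1 ∧
    -- (8) the Briançon–Skoda theorem
    (∀ (r : ℕ) (g : Fin r → R), 𝔞 = Ideal.span (Set.range g) →
      ∀ ℓ : ℕ, 1 ≤ ℓ → r ≤ ℓ →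
        TestIdeals.testIdeal p 𝔞 ℓ = 𝔞 * TestIdeals.testIdeal p 𝔞 ((ℓ : ℝ) - 1)) ∧
    -- (9) the restriction theorem
    (∀ x : R, TestIdeals.IsRegularParameter x → ∀ t : ℝ, 0 ≤ t →
      TestIdeals.testIdeal p (𝔞.map (Ideal.Quotient.mk (Ideal.span {x}))) t ≤
        (TestIdeals.testIdeal p 𝔞 t).map (Ideal.Quotient.mk (Ideal.span {x}))) ∧
    -- (10) the subadditivity theorem, also for mixed test ideals
    (∀ (k : Type*) [Field k] [PerfectField k] [Algebra k R] [Algebra.EssFiniteType k R],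
      (∀ t : ℝ, 0 ≤ t → ∀ n : ℕ,
        TestIdeals.testIdeal p 𝔞 (t * n) ≤ TestIdeals.testIdeal p 𝔞 t ^ n) ∧
      (∀ t s : ℝ, 0 ≤ t → 0 ≤ s →
        TestIdeals.mixedTestIdeal p 𝔞 𝔟 t s ≤
          TestIdeals.testIdeal p 𝔞 t * TestIdeals.testIdeal p 𝔟 s)) := by
  have hB := hF.hasFrobeniusBasis
  refine ⟨fun h t _ => TestIdeals.testIdeal_mono_left h t,
    fun t t' _ h => TestIdeals.testIdeal_anti_right 𝔞 h,
    fun n hn t ht => hB.testIdeal_pow 𝔞 hn ht,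
    fun W S _ _ _ t _ => hB.map_testIdeal W 𝔞 t,
    fun t ht => hB.testIdeal_idealIntegralClosure 𝔞 ht, fun t ht => ?_,
    TestIdeals.le_testIdeal_one 𝔞, ?_, fun x _ t _ => hB.testIdeal_map_le _ 𝔞 t,
    fun k _ _ _ _ => ⟨fun t ht n => hB.testIdeal_mul_le_pow 𝔞 ht n,
      fun t s _ _ => hB.mixedTestIdeal_le 𝔞 𝔟 t s⟩⟩
  · obtain ⟨s, hs, hle⟩ := hB.exists_gt_testIdeal_le 𝔞 ht
    refine ⟨s - t, sub_pos.2 hs, fun t' ht' =>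
      le_antisymm (TestIdeals.testIdeal_anti_right 𝔞 ht'.1) ?_⟩
    rw [add_sub_cancel] at ht'
    exact hle.trans (TestIdeals.testIdeal_anti_right 𝔞 ht'.2.le)
  · rintro r g rfl ℓ hℓ hr
    exact TestIdeals.testIdeal_span_range_eq_mul g hℓ hr
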